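/- Let $p$ be an odd prime. Let $ES_p(p^3)=\langle \alpha,\alpha_1,\alpha_2 \mid [\alpha_1,\alpha]=\alpha_2,\ [\alpha,\alpha_2]=[\alpha_1,\alpha_2]=1,\ \alpha^{p}=\alpha_1^p=\alpha_2^p=1\rangle$ be the extraspecial group of order $p^3$ and exponent $p$, and let $\phi_2(211)c=\langle \alpha,\alpha_1,\alpha_2 \mid [\alpha_1,\alpha]=\alpha_2,\ [\alpha,\alpha_2]=[\alpha_1,\alpha_2]=1,\ \alpha^{p^2}=\alpha_1^p=\alpha_2^p=1\rangle$. Put $$H_1=\phi_2(2111)d=ES_p(p^3)\times C_{p^2},\qquad H_2=\phi_2(2111)c=\phi_2(211)c\times C_p,$$ where $C_n$ denotes the cyclic group of order $n$. For a group $G$ and a $2$-cocycle $c\in Z^2(G,\mathbb C^\times)$ (trivial action of $G$ on $\mathbb C^\times$), let $\mathbb C^{c}G$ be the twisted group algebra, i.e. the $\mathbb C$-algebra with basis $(e_g)_{g\in G}$ and multiplication $e_ge_h=c(g,h)e_{gh}$; up to isomorphism it depends only on the class $[c]\in H^2(G,\mathbb C^\times)$. Then $H_1$ and $H_2$ are $\mathbb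 C$-twist isomorphic: there is a group isomorphism $\psi:H^2(H_1,\mathbb C^\times)\to H^2(H_2,\mathbb C^\times)$ such that for all $c\in Z^2(H_1,\mathbb C^\times)$ and $d\in Z^2(H_2,\mathbb C^\times)$ with $\psi([c])=[d]$, the $\mathbb C$-algebras $\mathbb C^{c}H_1$ and $\mathbb C^{d}H_2$ are isomorphic. -/

import Mathlib

noncomputable section

/-- `Rˣ` (written additively) as a `G`-module with trivial action. -/
abbrev unitsRep (G R : Type) [Group G] [CommRing R] : Rep ℤ G :=
  Rep.trivial ℤ G (Additive Rˣ)

/-- The group `Z²(G, Rˣ)` of 2-cocycles of `G` with values in the trivial `G`-module `Rˣ`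
(not necessarily normalized). -/
abbrev TwoCocycle (G R : Type) [Group G] [CommRing R] : Type :=
  groupCohomology.cocycles₂ (unitsRep G R)

/-- The second cohomology group `H²(G, Rˣ)`. -/
abbrev SchurH2 (G R : Type) [Group G] [CommRing R] : Type :=
  groupCohomology.H2 (unitsRep G R)

/-- The cohomology class `[c] ∈ H²(G, Rˣ)` of a 2-cocycle `c`. -/
abbrev TwoCocycle.cls {G R : Type} [Group G] [CommRing R] (c : TwoCocycle G R) : SchurH2 G R :=
  (groupCohomology.H2π (unitsRep G R)).hom c

/-- The value `c(g, h) ∈ Rˣ` of a 2-cocycle. -/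
def TwoCocycle.val {G R : Type} [Group G] [CommRing R] (c : TwoCocycle G R) (g h : G) : Rˣ :=
  Additive.toMul (c.1 (g, h))

theorem TwoCocycle.val_assoc {G R : Type} [Group G] [CommRing R] (c : TwoCocycle G R)
    (g h k : G) : c.val (g * h) k * c.val g h = c.val h k * c.val g (h * k) :=
  congrArg Additive.toMul ((groupCohomology.mem_cocycles₂_iff (A := unitsRep G R) c.1).1 c.2 g h k)

/-- The twisted group algebra `R^c G`: the free `R`-module with basis `(e_g)_{g ∈ G}` and the
`R`-bilinear multiplication determined by `e_g e_h = c(g, h) e_{gh}`. -/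
def TwistedGroupAlgebra {G R : Type} [Group G] [CommRing R] (_c : TwoCocycle G R) : Type :=
  G →₀ R

namespace TwistedGroupAlgebra

variable {G R : Type} [Group G] [CommRing R] (c : TwoCocycle G R)

instance : AddCommGroup (TwistedGroupAlgebra c) :=
  inferInstanceAs (AddCommGroup (G →₀ R))

instance : Module R (TwistedGroupAlgebra c) :=
  inferInstanceAs (Module R (G →₀ R))

/-- The basis `(e_g)_{g ∈ G}` of `R^c G`. -/
def basis : Module.Basis G R (TwistedGroupAlgebra c) :=
  ⟨LinearEquiv.refl R (G →₀ R)⟩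

/-- The bilinear multiplication of `R^c G`, given on the basis by `e_g e_h = c(g, h) e_{gh}`. -/
def mulLin :
    TwistedGroupAlgebra c →ₗ[R] TwistedGroupAlgebra c →ₗ[R] TwistedGroupAlgebra c :=
  (basis c).constr R fun g => (basis c).constr R fun h => (c.val g h : R) • basis c (g * h)

instance : Mul (TwistedGroupAlgebra c) := ⟨fun a b => mulLin c a b⟩

/-- The identity element is `c(1, 1)⁻¹ e_1`. -/
instance : One (TwistedGroupAlgebra c) := ⟨(((c.val 1 1)⁻¹ : Rˣ) : R) • basis c 1⟩

theorem mul_def (a b : TwistedGroupAlgebra c) : a * b = mulLin c a b := rfl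

theorem one_def : (1 : TwistedGroupAlgebra c) = (((c.val 1 1)⁻¹ : Rˣ) : R) • basis c 1 := rfl

theorem basis_mul_basis (g h : G) :
    basis c g * basis c h = (c.val g h : R) • basis c (g * h) := by
  simp [mul_def, mulLin, Module.Basis.constr_basis]

theorem induction_basis {P : TwistedGroupAlgebra c → Prop} (x : TwistedGroupAlgebra c)
    (hb : ∀ g, P (basis c g)) (h0 : P 0) (hadd : ∀ x y, P x → P y → P (x + y))
    (hsmul : ∀ (r : R) x, P x → P (r • x)) : P x := by
  refine Submodule.span_induction (p := fun x _ => P x) ?_ h0 (fun x y _ _ => hadd x y)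
    (fun r x _ => hsmul r x) ((basis c).mem_span x)
  rintro _ ⟨g, rfl⟩
  exact hb g

theorem mulLin_basis (g h : G) :
    mulLin c (basis c g) (basis c h) = (c.val g h : R) • basis c (g * h) :=
  basis_mul_basis c g h

theorem mulLin_assoc (x y z : TwistedGroupAlgebra c) :
    mulLin c (mulLin c x y) z = mulLin c x (mulLin c y z) := by
  induction x using induction_basis with
  | h0 => simp
  | hadd a b ha hb => simp [ha, hb]
  | hsmul r a ha => simp [ha]
  | hb g =>
  induction y using induction_basis with
  | h0 => simp
  | hadd a b ha hb => simp [ha, hb]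
  | hsmul r a ha => simp [ha]
  | hb h =>
  induction z using induction_basis with
  | h0 => simp
  | hadd a b ha hb => simp [ha, hb]
  | hsmul r a ha => simp [ha]
  | hb k =>
  have := congrArg (Units.val) (c.val_assoc g h k)
  simp only [Units.val_mul] at this
  simp only [mulLin_basis, map_smul, LinearMap.smul_apply, smul_smul, mul_assoc g h k]
  rw [mul_comm, this]

theorem one_mulLin (x : TwistedGroupAlgebra c) : mulLin c 1 x = x := by
  induction x using induction_basis with
  | h0 => simp
  | hadd a b ha hb => simp [ha, hb]
  | hsmul r a ha => simp [ha]
  | hb g =>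
  have h : c.val 1 g = c.val 1 1 := by
    simpa using (c.val_assoc 1 1 g).symm
  simp [one_def, mulLin_basis, smul_smul, h]

theorem mulLin_one (x : TwistedGroupAlgebra c) : mulLin c x 1 = x := by
  induction x using induction_basis with
  | h0 => simp
  | hadd a b ha hb => simp [ha, hb]
  | hsmul r a ha => simp [ha]
  | hb g =>
  have h : c.val g 1 = c.val 1 1 := by
    simpa using c.val_assoc g 1 1
  simp [one_def, mulLin_basis, smul_smul, h]

instance : Ring (TwistedGroupAlgebra c) :=
  { (inferInstance : AddCommGroup (TwistedGroupAlgebra c)) with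
    mul := (· * ·)
    one := 1
    mul_assoc := mulLin_assoc c
    one_mul := one_mulLin c
    mul_one := mulLin_one c
    left_distrib := fun a b d => map_add (mulLin c a) b d
    right_distrib := fun a b d => LinearMap.map_add₂ (mulLin c) a b d
    zero_mul := fun a => LinearMap.map_zero₂ (mulLin c) a
    mul_zero := fun a => map_zero (mulLin c a) }

instance : Algebra R (TwistedGroupAlgebra c) :=
  Algebra.ofModule (fun r a b => LinearMap.map_smul₂ (mulLin c) r a b)
    (fun r a b => map_smul (mulLin c a) r b)

end TwistedGroupAlgebra

/-- `G ∼_R H`: there is a group isomorphism `ψ : H²(G, Rˣ) ≃ H²(H, Rˣ)` such that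
`R^c G ≅ R^d H` as `R`-algebras whenever `ψ [c] = [d]`. -/
def TwistIsomorphic (R G H : Type) [CommRing R] [Group G] [Group H] : Prop :=
  ∃ ψ : SchurH2 G R ≃+ SchurH2 H R, ∀ (c : TwoCocycle G R) (d : TwoCocycle H R),
    ψ c.cls = d.cls → Nonempty (TwistedGroupAlgebra c ≃ₐ[R] TwistedGroupAlgebra d)

/-- Generators `α`, `α₁`, `α₂`. -/
inductive Phi2Gen : Type
  | a
  | a₁
  | a₂

open FreeGroup Phi2Gen commutatorElement in
/-- The relations `[α₁, α] = α₂`, `[α, α₂] = [α₁, α₂] = 1`, `α^m = α₁^p = α₂^p = 1`. In the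
presentations of `p`-groups by generators and relations used here, commutators of generators that
are not listed are understood to be trivial; this is spelled out as the centrality of `α₂`. -/
def phi2Rels (p m : ℕ) : Set (FreeGroup Phi2Gen) :=
  {⁅of a₁, of a⁆ * (of a₂)⁻¹, ⁅of a, of a₂⁆, ⁅of a₁, of a₂⁆, of a ^ m, of a₁ ^ p, of a₂ ^ p}

/-- `ES_p(p³)`, for odd `p` the extraspecial group of order `p³` and exponent `p`:
`⟨α, α₁, α₂ ∣ [α₁, α] = α₂, α^p = α₁^p = α₂^p = 1, α₂ central⟩`. -/
abbrev ES (p : ℕ) : Type := PresentedGroup (phi2Rels p p)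

/-- `φ₂(211)c = ⟨α, α₁, α₂ ∣ [α₁, α] = α₂, α^(p²) = α₁^p = α₂^p = 1, α₂ central⟩`. -/
abbrev Phi2_211c (p : ℕ) : Type := PresentedGroup (phi2Rels p (p ^ 2))

/-- `H₁ = φ₂(2111)d = ES_p(p³) × C_{p²}`. -/
abbrev Phi2_2111d (p : ℕ) : Type := ES p × Multiplicative (ZMod (p ^ 2))

/-- `H₂ = φ₂(2111)c = φ₂(211)c × C_p`. -/
abbrev Phi2_2111c (p : ℕ) : Type := Phi2_211c p × Multiplicative (ZMod p)

end

/-! Write Q = ES_p × C_p. Both groups are extensions of Q by a central cyclic group ⟨z⟩ of order p.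
In H₁, z is the p-th power of the generator of C_{p²}; in H₂, z = α^p. Two facts about z carry the
proof: some linear character χ is faithful on ⟨z⟩ (`SplitByCharacter`), and z lifts to a central
element of every central extension of the group by ℂˣ.

Together they make inflation H²(Q, ℂˣ) → H²(G, ℂˣ) an isomorphism for G = H₁, H₂. It is injective
because a cochain relating two inflated cocycles is, up to a constant, a character on ⟨z⟩, and
dividing by a power of χ makes it descend to Q (`cls_eq_of_comap_cls_eq`). It is surjective because
a central lift of z, rescaled to have order p, gives a ⟨z⟩-equivariant section whose factor set
lives on Q (`exists_comap_cls_eq`). The isomorphism ψ matches classes inflated from the same class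
of Q.

For an inflated cocycle, e_g ↦ (χ(g)^j e_{π g})_{j < p} identifies the twisted group algebra of G
with p copies of ℂ^a Q (`nonempty_algEquiv_pi`). This product is the same for both groups.

The central lift is a commutator computation. Generators commuting with the p-th root of z cause no
trouble: lifts of commuting elements commute up to a scalar, and this scalar has p-th power 1. The
only other generator is α₁ in H₂, where a computation in nilpotency class three uses that p is odd
(`commute_pow_of_class_three`). -/

noncomputable section

/-! ### Cocycles, cohomology classes and inflation -/

namespace TwoCocycle

variable {G Q R : Type} [Group G] [Group Q] [CommRing R]

/-- The 2-cocycle given by a function satisfying the cocycle identity. -/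
def ofVal (f : G → G → Rˣ)
    (hf : ∀ g h k, f (g * h) k * f g h = f h k * f g (h * k)) : TwoCocycle G R :=
  ⟨fun x => Additive.ofMul (f x.1 x.2),
    (groupCohomology.mem_cocycles₂_iff (A := unitsRep G R) _).2 fun g h k =>
      congrArg Additive.ofMul (hf g h k)⟩

theorem val_one_left (c : TwoCocycle G R) (g : G) : c.val 1 g = c.val 1 1 := by
  simpa using (c.val_assoc 1 1 g).symm

theorem val_one_right (c : TwoCocycle G R) (g : G) : c.val g 1 = c.val 1 1 := by
  simpa using c.val_assoc g 1 1

/-- Two cocycles are cohomologous iff they differ by the coboundary of a function. -/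
theorem cls_eq_iff (c d : TwoCocycle G R) :
    c.cls = d.cls ↔ ∃ β : G → Rˣ, ∀ g h, c.val g h * β (g * h) = β g * β h * d.val g h := by
  refine (groupCohomology.H2π_eq_iff c d).trans ⟨?_, ?_⟩
  · rintro ⟨f, hf⟩
    refine ⟨fun g => Additive.toMul (f g), fun g h => ?_⟩
    have h1 : f h - f (g * h) + f g = c.1 (g, h) - d.1 (g, h) := congrFun hf (g, h)
    have h2 : c.1 (g, h) + f (g * h) = f g + f h + d.1 (g, h) := by
      rw [← sub_eq_zero] at h1 ⊢
      rw [← neg_eq_zero, ← h1]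
      abel
    exact congrArg Additive.toMul h2
  · rintro ⟨β, hβ⟩
    refine ⟨fun g => Additive.ofMul (β g), funext fun ⟨g, h⟩ => ?_⟩
    have h2 : c.1 (g, h) + Additive.ofMul (β (g * h)) =
        Additive.ofMul (β g) + Additive.ofMul (β h) + d.1 (g, h) :=
      congrArg Additive.ofMul (hβ g h)
    change Additive.ofMul (β h) - Additive.ofMul (β (g * h)) + Additive.ofMul (β g) =
      c.1 (g, h) - d.1 (g, h)
    rw [← sub_eq_zero] at h2 ⊢
    rw [← neg_eq_zero, ← h2]
    abel

theorem cls_surjective : Function.Surjective (cls : TwoCocycle G R → SchurH2 G R) := fun x => by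
  induction x using groupCohomology.H2_induction_on with
  | h c => exact ⟨c, rfl⟩

/-- Pulling back cocycles along a group homomorphism. -/
def comap (π : G →* Q) : TwoCocycle Q R →+ TwoCocycle G R where
  toFun a := ofVal (fun g h => a.val (π g) (π h)) fun g h k => by
    simpa using a.val_assoc (π g) (π h) (π k)
  map_zero' := rfl
  map_add' _ _ := rfl

theorem comap_val (π : G →* Q) (a : TwoCocycle Q R) (g h : G) :
    (comap π a).val g h = a.val (π g) (π h) := rfl

/-- The class of the pullback of a cocycle. -/
def comapCls (R : Type) [CommRing R] (π : G →* Q) : TwoCocycle Q R →+ SchurH2 G R :=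
  (groupCohomology.H2π (unitsRep G R)).hom.toAddMonoidHom.comp (comap π)

end TwoCocycle

/-! ### Homomorphisms out of a twisted group algebra -/

namespace TwistedGroupAlgebra

variable {G R : Type} [Group G] [CommRing R]

/-- The algebra homomorphism out of `R^c G` determined by the images of the basis elements. -/
def lift (c : TwoCocycle G R) {A : Type} [Ring A] [Algebra R A] (f : G → A)
    (one : f 1 = (c.val 1 1 : R) • (1 : A))
    (mul : ∀ g h, f g * f h = (c.val g h : R) • f (g * h)) :
    TwistedGroupAlgebra c →ₐ[R] A :=
  AlgHom.ofLinearMap ((basis c).constr R f)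
    (by rw [one_def, map_smul, Module.Basis.constr_basis, one, smul_smul, Units.inv_mul, one_smul])
    (by
      intro x y
      induction x using induction_basis with
      | h0 => simp
      | hadd a b ha hb => simp [add_mul, ha, hb]
      | hsmul r a ha => simp [ha]
      | hb g =>
      induction y using induction_basis with
      | h0 => simp
      | hadd a b ha hb => simp [mul_add, ha, hb]
      | hsmul r a ha => simp [ha]
      | hb h =>
      rw [basis_mul_basis, map_smul, Module.Basis.constr_basis, Module.Basis.constr_basis,
        Module.Basis.constr_basis, mul])

theorem lift_basis (c : TwoCocycle G R) {A : Type} [Ring A] [Algebra R A] (f : G → A)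
    (one : f 1 = (c.val 1 1 : R) • (1 : A))
    (mul : ∀ g h, f g * f h = (c.val g h : R) • f (g * h)) (g : G) :
    lift c f one mul (basis c g) = f g :=
  (basis c).constr_basis R f g

theorem basis_one (c : TwoCocycle G R) : basis c 1 = (c.val 1 1 : R) • 1 := by
  rw [one_def, smul_smul, Units.mul_inv, one_smul]

/-- Cohomologous cocycles have isomorphic twisted group algebras. -/
theorem nonempty_algEquiv_of_cls_eq {c d : TwoCocycle G R} (h : c.cls = d.cls) :
    Nonempty (TwistedGroupAlgebra c ≃ₐ[R] TwistedGroupAlgebra d) := by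
  obtain ⟨β, hβ⟩ := (TwoCocycle.cls_eq_iff c d).1 h
  -- Cocycles need not be normalized, so preservation of the unit is a separate condition: the
  -- relation at g = h = 1.
  have hβ1 : c.val 1 1 = β 1 * d.val 1 1 := by
    have := hβ 1 1
    rw [mul_one, mul_right_comm] at this
    exact mul_right_cancel this
  let F : TwistedGroupAlgebra c →ₐ[R] TwistedGroupAlgebra d :=
    lift c (fun g => (β g : R) • basis d g)
      (by rw [basis_one, smul_smul, hβ1, Units.val_mul])
      (fun g h => by
        rw [smul_mul_smul_comm, basis_mul_basis, smul_smul, smul_smul, ← Units.val_mul,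
          ← Units.val_mul, ← Units.val_mul, hβ])
  let F' : TwistedGroupAlgebra d →ₐ[R] TwistedGroupAlgebra c :=
    lift d (fun g => ((β g)⁻¹ : Rˣ).val • basis c g)
      (by rw [basis_one, smul_smul, hβ1, ← Units.val_mul, inv_mul_cancel_left])
      (fun g h => by
        rw [smul_mul_smul_comm, basis_mul_basis, smul_smul, smul_smul, ← Units.val_mul,
          ← Units.val_mul, ← Units.val_mul]
        congr 2
        rw [eq_mul_inv_iff_mul_eq, mul_assoc, hβ, ← mul_inv, inv_mul_cancel_left])
  have hF : ∀ g, F (basis c g) = (β g : R) • basis d g := lift_basis c _ _ _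
  have hF' : ∀ g, F' (basis d g) = ((β g)⁻¹ : Rˣ).val • basis c g := lift_basis d _ _ _
  refine ⟨AlgEquiv.ofAlgHom F F' ?_ ?_⟩
  · refine AlgHom.toLinearMap_injective ((basis d).ext fun g => ?_)
    simp [hF, hF', smul_smul]
  · refine AlgHom.toLinearMap_injective ((basis c).ext fun g => ?_)
    simp [hF, hF', smul_smul]

end TwistedGroupAlgebra

/-! ### The central extension attached to a cocycle -/

/-- The central extension of `G` by `Rˣ` defined by a 2-cocycle: pairs `(a, g)` with
`(a, g) (b, h) = (a b c(g, h), g h)`. -/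
@[ext]
structure CocycleExtension {G R : Type} [Group G] [CommRing R] (c : TwoCocycle G R) : Type where
  coeff : Rˣ
  base : G

namespace CocycleExtension

variable {G R : Type} [Group G] [CommRing R] (c : TwoCocycle G R)

instance : Mul (CocycleExtension c) :=
  ⟨fun x y => ⟨x.coeff * y.coeff * c.val x.base y.base, x.base * y.base⟩⟩

instance : One (CocycleExtension c) := ⟨⟨(c.val 1 1)⁻¹, 1⟩⟩

instance : Inv (CocycleExtension c) :=
  ⟨fun x => ⟨(c.val 1 1)⁻¹ * (c.val x.base⁻¹ x.base)⁻¹ * x.coeff⁻¹, x.base⁻¹⟩⟩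

theorem mul_coeff (x y : CocycleExtension c) :
    (x * y).coeff = x.coeff * y.coeff * c.val x.base y.base := rfl

theorem mul_base (x y : CocycleExtension c) : (x * y).base = x.base * y.base := rfl

instance : Group (CocycleExtension c) :=
  Group.ofLeftAxioms
    (fun x y z => by
      ext1
      · have := c.val_assoc x.base y.base z.base
        simp only [mul_coeff, mul_base]
        calc _ = x.coeff * y.coeff * z.coeff *
              (c.val (x.base * y.base) z.base * c.val x.base y.base) := by
              simp only [mul_comm, mul_left_comm, mul_assoc]
          _ = _ := by rw [this]; simp only [mul_comm, mul_left_comm, mul_assoc]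
      · exact mul_assoc _ _ _)
    (fun x => by
      ext1
      · change (c.val 1 1)⁻¹ * x.coeff * c.val 1 x.base = x.coeff
        rw [c.val_one_left x.base, mul_right_comm, inv_mul_cancel, one_mul]
      · exact one_mul _)
    (fun x => by
      ext1
      · change (c.val 1 1)⁻¹ * (c.val x.base⁻¹ x.base)⁻¹ * x.coeff⁻¹ * x.coeff *
          c.val x.base⁻¹ x.base = (c.val 1 1)⁻¹
        rw [inv_mul_cancel_right, inv_mul_cancel_right]
      · exact inv_mul_cancel _)

/-- The projection onto `G`. -/
def proj : CocycleExtension c →* G where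
  toFun := base
  map_one' := rfl
  map_mul' _ _ := rfl

theorem proj_apply (x : CocycleExtension c) : proj c x = x.base := rfl

/-- The inclusion of `Rˣ`. -/
def incl : Rˣ →* CocycleExtension c where
  toFun a := ⟨a * (c.val 1 1)⁻¹, 1⟩
  map_one' := by
    ext1
    · exact one_mul _
    · rfl
  map_mul' a b := by
    ext1
    · change a * b * (c.val 1 1)⁻¹ = a * (c.val 1 1)⁻¹ * (b * (c.val 1 1)⁻¹) * c.val 1 1
      rw [mul_assoc (a * _), inv_mul_cancel_right, mul_right_comm]
    · exact (one_mul _).symm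

theorem incl_mul (a : Rˣ) (x : CocycleExtension c) :
    incl c a * x = ⟨a * x.coeff, x.base⟩ := by
  ext1
  · change a * (c.val 1 1)⁻¹ * x.coeff * c.val 1 x.base = a * x.coeff
    rw [c.val_one_left x.base, mul_assoc a, mul_assoc a, mul_right_comm, inv_mul_cancel, one_mul]
  · exact one_mul _

theorem mul_incl (a : Rˣ) (x : CocycleExtension c) :
    x * incl c a = ⟨a * x.coeff, x.base⟩ := by
  ext1
  · change x.coeff * (a * (c.val 1 1)⁻¹) * c.val x.base 1 = a * x.coeff
    rw [c.val_one_right x.base, ← mul_assoc, inv_mul_cancel_right, mul_comm]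
  · exact mul_one _

theorem commute_incl (a : Rˣ) (x : CocycleExtension c) : Commute (incl c a) x :=
  (incl_mul c a x).trans (mul_incl c a x).symm

theorem exists_eq_incl_mul {x y : CocycleExtension c} (h : x.base = y.base) :
    ∃ a, x = incl c a * y := by
  refine ⟨x.coeff * y.coeff⁻¹, ?_⟩
  rw [incl_mul, inv_mul_cancel_right, ← h]

theorem exists_eq_incl {x : CocycleExtension c} (h : x.base = 1) : ∃ a, x = incl c a := by
  obtain ⟨a, ha⟩ := exists_eq_incl_mul c (x := x) (y := 1) h
  exact ⟨a, by rwa [mul_one] at ha⟩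

theorem commute_of_base_eq_one {x : CocycleExtension c} (h : x.base = 1)
    (y : CocycleExtension c) : Commute x y := by
  obtain ⟨a, rfl⟩ := exists_eq_incl c h
  exact commute_incl c a y

theorem pow_base (x : CocycleExtension c) (n : ℕ) : (x ^ n).base = x.base ^ n :=
  map_pow (proj c) x n

theorem zpow_base (x : CocycleExtension c) (n : ℤ) : (x ^ n).base = x.base ^ n :=
  map_zpow (proj c) x n

theorem inv_base (x : CocycleExtension c) : (x⁻¹).base = x.base⁻¹ := rfl

/-- An element of the extension is central as soon as it commutes with lifts of generators. -/
theorem commute_of_closure_eq_top {S : Set G} (hS : Subgroup.closure S = ⊤)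
    {x : CocycleExtension c} (hx : ∀ s ∈ S, ∃ y : CocycleExtension c, y.base = s ∧ Commute x y)
    (y : CocycleExtension c) : Commute x y := by
  have key : Subgroup.closure S ≤ (Subgroup.centralizer {x}).map (proj c) := by
    rw [Subgroup.closure_le]
    intro s hs
    obtain ⟨y, hy, hxy⟩ := hx s hs
    exact ⟨y, Subgroup.mem_centralizer_singleton_iff.2 hxy.symm, hy⟩
  obtain ⟨z, hz, hzy⟩ := key (hS ▸ Subgroup.mem_top y.base)
  have hz' : Commute x z := (Subgroup.mem_centralizer_singleton_iff.1 hz).symm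
  obtain ⟨a, rfl⟩ := exists_eq_incl_mul c (x := y) (y := z) hzy.symm
  exact (commute_incl c a x).symm.mul_right hz'

end CocycleExtension

end

/-! ### Powers and commutators in groups of class two and three -/

section GroupPowers

variable {Γ : Type*} [Group Γ]

theorem mul_pow_eq_pow_mul_mul_pow {x y m : Γ} (h : x * y = m * (y * x)) (hx : Commute m x)
    (n : ℕ) : x ^ n * y = m ^ n * (y * x ^ n) := by
  induction n with
  | zero => simp
  | succ n ih =>
    calc x ^ (n + 1) * y = x * (x ^ n * y) := by rw [pow_succ', mul_assoc]
      _ = (x * m ^ n) * (y * x ^ n) := by rw [ih]; simp only [mul_assoc]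
      _ = m ^ n * (x * y) * x ^ n := by rw [← (hx.pow_left n).eq]; simp only [mul_assoc]
      _ = m ^ (n + 1) * (y * x ^ (n + 1)) := by
        rw [h, pow_succ, pow_succ']; simp only [mul_assoc]

theorem mul_pow_mul_eq_pow_mul {x y m : Γ} (h : x * y = m * (y * x)) (hy : Commute m y)
    (n : ℕ) : x * y ^ n = m ^ n * (y ^ n * x) := by
  have h' : y * x = m⁻¹ * (x * y) := by rw [h, inv_mul_cancel_left]
  have := mul_pow_eq_pow_mul_mul_pow h' hy.inv_left n
  rw [this, inv_pow, mul_inv_cancel_left]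

/-- If the commutator of `x` and `y` is central in `⟨x, y⟩` and `y ^ n` commutes with `x`, then
`x ^ n` commutes with `y`. -/
theorem commute_pow_left_of_commute_pow_right {x y m : Γ} (h : x * y = m * (y * x))
    (hx : Commute m x) (hy : Commute m y) {n : ℕ} (hn : Commute x (y ^ n)) :
    m ^ n = 1 ∧ Commute (x ^ n) y := by
  have h1 : m ^ n = 1 := by
    have := mul_pow_mul_eq_pow_mul h hy n
    rw [hn.eq] at this
    exact (mul_eq_right.1 this.symm)
  refine ⟨h1, ?_⟩
  have := mul_pow_eq_pow_mul_mul_pow h hx n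
  rwa [h1, one_mul] at this

/-- Collection in class two: moving one more x past n copies of y costs m ^ n, and these costs add
up to the binomial coefficient. -/
theorem pow_choose_two_mul_mul_pow {x y m : Γ} (h : x * y = m * (y * x)) (hx : Commute m x)
    (hy : Commute m y) (n : ℕ) : m ^ (n.choose 2) * (x * y) ^ n = x ^ n * y ^ n := by
  induction n with
  | zero => simp
  | succ n ih =>
    have hc : (n + 1).choose 2 = n + n.choose 2 := by
      rw [Nat.choose_succ_succ' n 1, Nat.choose_one_right]
    have hxn := mul_pow_mul_eq_pow_mul h hy n
    have hmx := ((hx.pow_left n).pow_right n).eq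
    calc m ^ ((n + 1).choose 2) * (x * y) ^ (n + 1)
        = m ^ n * (m ^ (n.choose 2) * (x * y) ^ n) * (x * y) := by
          rw [hc, pow_add, pow_succ]; simp only [mul_assoc]
      _ = (m ^ n * x ^ n) * (y ^ n * x) * y := by rw [ih]; simp only [mul_assoc]
      _ = x ^ n * (m ^ n * (y ^ n * x)) * y := by rw [hmx]; simp only [mul_assoc]
      _ = x ^ (n + 1) * y ^ (n + 1) := by
          rw [← hxn, pow_succ, pow_succ]
          simp only [mul_assoc]

/-- An odd n divides n(n - 1)/2, so the correction term of the collection formula vanishes. This is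
the source of the restriction to odd p. -/
theorem mul_pow_of_odd {x y m : Γ} (h : x * y = m * (y * x)) (hx : Commute m x)
    (hy : Commute m y) {n : ℕ} (hn : Odd n) (hm : m ^ n = 1) :
    (x * y) ^ n = x ^ n * y ^ n := by
  have hd : n ∣ n.choose 2 := by
    obtain ⟨k, rfl⟩ := hn
    rw [Nat.choose_two_right, Nat.add_sub_cancel, mul_left_comm,
      Nat.mul_div_cancel_left _ two_pos]
    exact dvd_mul_right _ _
  obtain ⟨k, hk⟩ := hd
  have := pow_choose_two_mul_mul_pow h hx hy n
  rwa [hk, pow_mul, hm, one_pow, one_mul] at this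

/-- Let `w = [b, a]` have central commutators with `a` and `b`, and let the `n`-th powers of `b`
and `w` be central in `⟨a, b⟩`, with `n` odd. Then `a ^ n` commutes with `b`. -/
theorem commute_pow_of_class_three {a b w m k : Γ} (hw : b * a = w * (a * b))
    (hm : w * a = m * (a * w)) (hk : w * b = k * (b * w))
    (hma : Commute m a) (hmw : Commute m w) (hkb : Commute k b) (hkw : Commute k w)
    {n : ℕ} (hn : Odd n) (hbn : Commute a (b ^ n)) (hwa : Commute a (w ^ n))
    (hwb : Commute b (w ^ n)) : Commute (a ^ n) b := by
  -- By bilinearity of the commutator here, [w, a]^n = [w^n, a] = 1; the same argument with b gives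
  -- k ^ n = 1.
  have hm1 : m ^ n = 1 := by
    have h := mul_pow_eq_pow_mul_mul_pow hm hmw n
    rw [← hwa.eq] at h
    exact mul_eq_right.1 h.symm
  have hk1 : k ^ n = 1 := by
    have h := mul_pow_eq_pow_mul_mul_pow hk hkw n
    rw [← hwb.eq] at h
    exact mul_eq_right.1 h.symm
  -- Conjugation by b sends a to w a, so it sends a ^ n to (w a)^n. It remains to show w ^ n = 1.
  have hA : b * a ^ n * b⁻¹ = w ^ n * a ^ n := by
    rw [← mul_pow_of_odd hm hmw hma hn hm1, ← conj_pow, hw]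
    simp only [mul_assoc, mul_inv_cancel, mul_one]
  have hb : a * b * a⁻¹ = w⁻¹ * b := by
    rw [eq_comm, inv_mul_eq_iff_eq_mul, ← mul_assoc, eq_mul_inv_iff_mul_eq, hw]
  have hk' : w⁻¹ * b = k⁻¹ * (b * w⁻¹) := by
    rw [inv_mul_eq_iff_eq_mul, ← mul_assoc, ← mul_assoc, eq_mul_inv_iff_mul_eq, mul_assoc w,
      ← mul_assoc w, ← hkw.inv_left.eq, mul_assoc, hk, inv_mul_cancel_left]
  -- Conjugation by a sends b to w⁻¹ b, hence b ^ n to w⁻ⁿ b ^ n; but it fixes b ^ n.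
  have hB : w ^ n = 1 := by
    have h : a * b ^ n * a⁻¹ = (w ^ n)⁻¹ * b ^ n := by
      rw [← inv_pow, ← mul_pow_of_odd hk' hkw.inv_inv hkb.inv_left hn (by rw [inv_pow, hk1, inv_one]),
        ← hb, conj_pow]
    rw [hbn.eq, mul_inv_cancel_right] at h
    exact inv_eq_one.1 (mul_eq_right.1 h.symm)
  rw [hB, one_mul, mul_inv_eq_iff_eq_mul] at hA
  exact hA.symm

end GroupPowers

/-! ### Inflation from a quotient by a cyclic kernel with a faithful character -/

noncomputable section

open Module TwistedGroupAlgebra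

theorem sum_fin_pow_eq_zero {K : Type*} [Field K] {p : ℕ} {r : K} (hr : r ≠ 1) (hrp : r ^ p = 1) :
    ∑ k : Fin p, r ^ (k : ℕ) = 0 := by
  rw [Fin.sum_univ_eq_sum_range (fun k => r ^ k) p, geom_sum_eq hr, hrp, sub_self, zero_div]

/-- A surjection `π : G → Q` whose kernel is generated by an element `z` of order `p`, together
with a linear character of `G` that is faithful on the kernel. -/
structure SplitByCharacter {G Q : Type} [Group G] [Group Q] (p : ℕ) (π : G →* Q) (z : G)
    (χ : G →* ℂˣ) : Prop where
  surjective : Function.Surjective π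
  ker_eq : π.ker = Subgroup.zpowers z
  pow_eq_one : z ^ p = 1
  primitive : IsPrimitiveRoot (χ z) p

namespace SplitByCharacter

variable {G Q : Type} [Group G] [Group Q] {p : ℕ} {π : G →* Q} {z : G} {χ : G →* ℂˣ}

theorem zpow_eq_one_iff (h : SplitByCharacter p π z χ) (n : ℤ) : z ^ n = 1 ↔ (p : ℤ) ∣ n := by
  constructor
  · intro hn
    rw [← h.primitive.zpow_eq_one_iff_dvd, ← map_zpow, hn, map_one]
  · rintro ⟨k, rfl⟩
    rw [zpow_mul, zpow_natCast, h.pow_eq_one, one_zpow]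

theorem map_zpow_eq_one (h : SplitByCharacter p π z χ) (n : ℤ) : π (z ^ n) = 1 := by
  rw [← MonoidHom.mem_ker, h.ker_eq]
  exact ⟨n, rfl⟩

theorem exists_eq_mul_zpow (h : SplitByCharacter p π z χ) {g g' : G} (hg : π g = π g') :
    ∃ n : ℤ, g' = g * z ^ n := by
  have : g⁻¹ * g' ∈ Subgroup.zpowers z := by
    rw [← h.ker_eq, MonoidHom.mem_ker, map_mul, map_inv, hg, inv_mul_cancel]
  obtain ⟨n, hn⟩ := this
  exact ⟨n, by rw [show z ^ n = g⁻¹ * g' from hn, mul_inv_cancel_left]⟩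

/-- A cocycle is cohomologous to a pullback along `π` if the generator of the kernel lifts to a
central element of the corresponding extension. -/
theorem exists_comap_cls_eq (h : SplitByCharacter p π z χ) (hp : p ≠ 0) (c : TwoCocycle G ℂ)
    (x : CocycleExtension c) (hx : x.base = z) (hcen : ∀ y, Commute x y) :
    ∃ a : TwoCocycle Q ℂ, (TwoCocycle.comap π a).cls = c.cls := by
  -- The p-th power of the given lift is a scalar; dividing the lift by a p-th root of this scalar
  -- makes its order match that of z.
  obtain ⟨ζ, hζb, hζc, hζp⟩ : ∃ ζ : CocycleExtension c, ζ.base = z ∧ (∀ y, Commute ζ y) ∧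
      ζ ^ p = 1 := by
    obtain ⟨a, ha⟩ := CocycleExtension.exists_eq_incl c (x := x ^ p)
      (by rw [CocycleExtension.pow_base, hx, h.pow_eq_one])
    obtain ⟨b, hb⟩ := IsAlgClosed.exists_pow_nat_eq (a : ℂ) (Nat.pos_of_ne_zero hp)
    have hb0 : b ≠ 0 := by
      rintro rfl
      rw [zero_pow hp] at hb
      exact a.ne_zero hb.symm
    have hab : a = (Units.mk0 b hb0) ^ p := by
      ext
      simp [hb]
    refine ⟨CocycleExtension.incl c (Units.mk0 b hb0)⁻¹ * x, ?_, fun y => ?_, ?_⟩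
    · rw [CocycleExtension.incl_mul, hx]
    · exact (CocycleExtension.commute_incl c _ y).mul_left (hcen y)
    · rw [(CocycleExtension.commute_incl c _ x).mul_pow, ha, ← map_pow, ← map_mul, hab, inv_pow,
        inv_mul_cancel, map_one]
  have hzc : ∀ g, Commute z g := fun g => by
    have := congrArg (CocycleExtension.proj c) (hcen ⟨1, g⟩).eq
    rw [map_mul, map_mul] at this
    rwa [CocycleExtension.proj_apply, CocycleExtension.proj_apply, hx] at this
  have hζ : ∀ n k : ℤ, z ^ n = z ^ k → ζ ^ n = ζ ^ k := by
    intro n k hnk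
    have h1 : z ^ (n - k) = 1 := by rw [zpow_sub, hnk, mul_inv_cancel]
    obtain ⟨j, hj⟩ := (h.zpow_eq_one_iff _).1 h1
    rw [← mul_inv_eq_one, ← zpow_sub, hj, zpow_mul, zpow_natCast, hζp, one_zpow]
  let s : Q → G := Function.surjInv h.surjective
  have hs : ∀ q, π (s q) = q := Function.surjInv_eq h.surjective
  have hn : ∀ g, ∃ n : ℤ, g = s (π g) * z ^ n := fun g => h.exists_eq_mul_zpow (hs _)
  choose n hn using hn
  -- A section chosen freely on coset representatives and extended equivariantly, with z acting
  -- through ζ.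
  let w : G → CocycleExtension c := fun g => ⟨1, s (π g)⟩ * ζ ^ n g
  have hwb : ∀ g, (w g).base = g := fun g => by
    change s (π g) * (ζ ^ n g).base = g
    rw [CocycleExtension.zpow_base, hζb, ← hn]
  have hw : ∀ g (k : ℤ), w (g * z ^ k) = w g * ζ ^ k := by
    intro g k
    have hπ : π (g * z ^ k) = π g := by rw [map_mul, h.map_zpow_eq_one, mul_one]
    have h1 : z ^ n (g * z ^ k) = z ^ (n g + k) := by
      apply mul_left_cancel (a := s (π g))
      have := hn (g * z ^ k)
      rw [hπ] at this
      rw [← this, zpow_add, ← mul_assoc, ← hn]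
    change (⟨1, s (π (g * z ^ k))⟩ : CocycleExtension c) * ζ ^ _ = ⟨1, s (π g)⟩ * ζ ^ n g * ζ ^ k
    rw [hπ, hζ _ _ h1, zpow_add, mul_assoc]
  clear_value w
  let f : Q → Q → ℂˣ := fun q r =>
    (w (s q) * w (s r)).coeff * ((w (s q * s r)).coeff)⁻¹
  -- Since ζ is central and w is equivariant, the powers of ζ cancel on both sides, so the factor
  -- set depends only on cosets.
  have hf : ∀ g g', w g * w g' = CocycleExtension.incl c (f (π g) (π g')) * w (g * g') := by
    intro g g'
    have h0 : w (s (π g)) * w (s (π g')) =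
        CocycleExtension.incl c (f (π g) (π g')) * w (s (π g) * s (π g')) := by
      rw [CocycleExtension.incl_mul]
      ext1
      · exact (inv_mul_cancel_right _ _).symm
      · rw [CocycleExtension.mul_base, hwb, hwb, hwb]
    have h1 : w g = w (s (π g)) * ζ ^ n g := by rw [← hw, ← hn]
    have h2 : w g' = w (s (π g')) * ζ ^ n g' := by rw [← hw, ← hn]
    have h3 : g * g' = s (π g) * s (π g') * z ^ (n g + n g') := by
      conv_lhs => rw [hn g, hn g']
      rw [zpow_add, mul_assoc, ← mul_assoc (z ^ n g), ((hzc (s (π g'))).zpow_left (n g)).eq]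
      simp only [mul_assoc]
    rw [h3, hw, ← mul_assoc, ← h0, h1, h2, mul_assoc, ← mul_assoc (ζ ^ n g),
      ((hζc (w (s (π g')))).zpow_left (n g)).eq, zpow_add]
    simp only [mul_assoc]
  have hval : ∀ g g', f (π g) (π g') * (w (g * g')).coeff =
      (w g).coeff * (w g').coeff * c.val g g' := by
    intro g g'
    have := congrArg CocycleExtension.coeff (hf g g')
    rw [CocycleExtension.incl_mul, CocycleExtension.mul_coeff, hwb, hwb] at this
    exact this.symm
  let a : TwoCocycle Q ℂ := TwoCocycle.ofVal f (by
    intro q r t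
    obtain ⟨g, rfl⟩ := h.surjective q
    obtain ⟨g', rfl⟩ := h.surjective r
    obtain ⟨g'', rfl⟩ := h.surjective t
    have assoc := mul_assoc (w g) (w g') (w g'')
    rw [hf g g', mul_assoc, hf (g * g') g'', hf g' g'', ← mul_assoc (w g),
      ← (CocycleExtension.commute_incl c _ (w g)).eq, mul_assoc (CocycleExtension.incl c _) (w g),
      hf g (g' * g''), ← mul_assoc, ← mul_assoc, ← map_mul, ← map_mul, mul_assoc g g' g'',
      mul_left_inj] at assoc
    have := mul_right_cancel (b := (c.val 1 1)⁻¹) (congrArg CocycleExtension.coeff assoc)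
    rw [← map_mul, ← map_mul, mul_comm, this])
  exact ⟨a, (TwoCocycle.cls_eq_iff _ _).2 ⟨fun g => (w g).coeff, hval⟩⟩

/-- Inflation along `π` is injective on cohomology classes. -/
theorem cls_eq_of_comap_cls_eq (h : SplitByCharacter p π z χ) (hp : p ≠ 0) {a b : TwoCocycle Q ℂ}
    (hab : (TwoCocycle.comap π a).cls = (TwoCocycle.comap π b).cls) : a.cls = b.cls := by
  obtain ⟨β, hβ⟩ := (TwoCocycle.cls_eq_iff _ _).1 hab
  simp only [TwoCocycle.comap_val] at hβ
  have hz1 : π z = 1 := by simpa using h.map_zpow_eq_one 1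
  -- The factor by which β changes under translation by z; the values at (1, 1) account for
  -- unnormalized cocycles. It is a p-th root of unity, hence a power of χ z.
  let k : ℂˣ := β z * b.val 1 1 * (a.val 1 1)⁻¹
  have hk : ∀ g, β (g * z) = β g * k := fun g => by
    have := hβ g z
    rw [hz1, a.val_one_right, b.val_one_right] at this
    rw [← mul_right_inj (a.val 1 1), this]
    change _ = a.val 1 1 * (β g * (β z * b.val 1 1 * (a.val 1 1)⁻¹))
    rw [mul_comm (a.val 1 1), mul_assoc (β g), mul_assoc (β g), inv_mul_cancel_right]
  have hkn : ∀ m : ℕ, β (z ^ m) = β 1 * k ^ m := fun m => by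
    induction m with
    | zero => simp
    | succ m ih => rw [pow_succ, hk, ih, pow_succ, mul_assoc]
  have hkp : k ^ p = 1 := by
    have := hkn p
    rw [h.pow_eq_one] at this
    exact mul_eq_left.1 this.symm
  have : NeZero p := ⟨hp⟩
  obtain ⟨m, -, hm⟩ := (IsPrimitiveRoot.coe_units_iff.2 h.primitive).eq_pow_of_pow_eq_one
    (ξ := (k : ℂ)) (by rw [← Units.val_pow_eq_pow_val, hkp, Units.val_one])
  have hm : χ z ^ m = k := by
    ext
    rw [← hm, Units.val_pow_eq_pow_val]
  -- Dividing by a homomorphism leaves the coboundary unchanged and cancels k, so γ is constant on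
  -- cosets of ⟨z⟩.
  let γ : G → ℂˣ := fun g => β g * (χ g ^ m)⁻¹
  have hγ : ∀ g g', a.val (π g) (π g') * γ (g * g') = γ g * γ g' * b.val (π g) (π g') := by
    intro g g'
    change _ * (_ * _) = _ * _ * (_ * _) * _
    rw [← mul_assoc, hβ, map_mul, mul_pow, mul_inv]
    simp only [mul_comm, mul_left_comm, mul_assoc]
  have hγz : ∀ g, γ (g * z) = γ g := fun g => by
    change _ * _ = _ * _
    rw [hk, map_mul, mul_pow, hm, mul_inv, mul_comm _ k⁻¹, mul_assoc, mul_inv_cancel_left]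
  have hγn : ∀ g (i : ℤ), γ (g * z ^ i) = γ g := fun g i => by
    induction i with
    | zero => simp
    | succ i ih => rw [zpow_add_one, ← mul_assoc, hγz, ih]
    | pred i ih => rw [← hγz, mul_assoc, ← zpow_add_one, sub_add_cancel, ih]
  refine (TwoCocycle.cls_eq_iff _ _).2
    ⟨fun q => γ (Function.surjInv h.surjective q), fun q r => ?_⟩
  have hs : ∀ g, γ (Function.surjInv h.surjective (π g)) = γ g := fun g => by
    obtain ⟨i, hi⟩ := h.exists_eq_mul_zpow (Function.surjInv_eq h.surjective (π g)).symm
    rw [hi, hγn]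
  obtain ⟨g, rfl⟩ := h.surjective q
  obtain ⟨g', rfl⟩ := h.surjective r
  rw [← map_mul]
  simp only [hs, hγ]

theorem comap_cls_eq_of_cls_eq {R : Type} [CommRing R] (π : G →* Q) {a b : TwoCocycle Q R}
    (hab : a.cls = b.cls) : (TwoCocycle.comap π a).cls = (TwoCocycle.comap π b).cls := by
  obtain ⟨β, hβ⟩ := (TwoCocycle.cls_eq_iff _ _).1 hab
  refine (TwoCocycle.cls_eq_iff _ _).2 ⟨fun g => β (π g), fun g g' => ?_⟩
  simp only [TwoCocycle.comap_val, map_mul, hβ]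

/-- The right-hand side involves only Q, so all groups over Q with such a character share this
kernel. -/
theorem comapCls_ker (h : SplitByCharacter p π z χ) (hp : p ≠ 0) :
    (TwoCocycle.comapCls ℂ π).ker =
      (groupCohomology.H2π (unitsRep Q ℂ)).hom.toAddMonoidHom.ker := by
  have h0 : TwoCocycle.comapCls ℂ π 0 = 0 := map_zero _
  have h0' : (0 : TwoCocycle Q ℂ).cls = 0 := map_zero _
  ext a
  rw [AddMonoidHom.mem_ker, AddMonoidHom.mem_ker, ← h0]
  change _ ↔ a.cls = 0
  rw [← h0']
  exact ⟨h.cls_eq_of_comap_cls_eq hp, comap_cls_eq_of_cls_eq π⟩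

/-- The twisted group algebra of a pulled back cocycle is a product of copies of the twisted group
algebra of the quotient, one for each power of the character. -/
theorem nonempty_algEquiv_pi (h : SplitByCharacter p π z χ) (hp : p ≠ 0) (a : TwoCocycle Q ℂ) :
    Nonempty (TwistedGroupAlgebra (TwoCocycle.comap π a) ≃ₐ[ℂ]
      (Fin p → TwistedGroupAlgebra a)) := by
  classical
  have hp0 : (p : ℂ) ≠ 0 := Nat.cast_ne_zero.2 hp
  let F : TwistedGroupAlgebra (TwoCocycle.comap π a) →ₐ[ℂ] (Fin p → TwistedGroupAlgebra a) :=
    lift _ (fun g j => ((χ g : ℂ) ^ (j : ℕ)) • basis a (π g))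
      (by
        funext j
        simp [basis_one, TwoCocycle.comap_val])
      (fun g g' => by
        funext j
        simp only [Pi.mul_apply, Pi.smul_apply, smul_mul_smul_comm, basis_mul_basis, smul_smul,
          map_mul, Units.val_mul, mul_pow, TwoCocycle.comap_val]
        rw [mul_comm])
  have hF : ∀ g j, F (basis _ g) j = ((χ g : ℂ) ^ (j : ℕ)) • basis a (π g) :=
    fun g j => congrFun (lift_basis _ _ _ _ g) j
  have geom : ∀ g g', π g = π g' → g ≠ g' →
      ∑ j : Fin p, ((χ g : ℂ)⁻¹ * (χ g' : ℂ)) ^ (j : ℕ) = 0 := by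
    intro g g' hg hne
    obtain ⟨n, rfl⟩ := h.exists_eq_mul_zpow hg
    have hχ : (χ g : ℂ)⁻¹ * (χ (g * z ^ n) : ℂ) = (χ z : ℂ) ^ n := by
      simp
    have hroot := IsPrimitiveRoot.coe_units_iff.2 h.primitive
    have h1 : (χ z : ℂ) ^ n ≠ 1 := fun h1 => by
      rw [hroot.zpow_eq_one_iff_dvd, ← h.zpow_eq_one_iff] at h1
      exact hne (by rw [h1, mul_one])
    rw [hχ]
    refine sum_fin_pow_eq_zero h1 ?_
    rw [← zpow_natCast, zpow_comm, zpow_natCast, hroot.pow_eq_one, one_zpow]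
  have hinj : Function.Injective F := by
    -- Fourier inversion along the cosets of ⟨z⟩: each coefficient of x is recovered from F x. As G
    -- may be infinite, injectivity and surjectivity are proved separately.
    have key : ∀ (g : G) (x : TwistedGroupAlgebra (TwoCocycle.comap π a)),
        ∑ j : Fin p, ((χ g : ℂ)⁻¹) ^ (j : ℕ) * (basis a).repr (F x j) (π g) =
          p * (basis _).repr x g := by
      intro g x
      induction x using induction_basis with
      | h0 => simp
      | hadd x y hx hy => simp only [map_add, Pi.add_apply, Finsupp.add_apply, mul_add,
          Finset.sum_add_distrib, hx, hy]
      | hsmul r x hx =>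
        simp only [map_smul, Pi.smul_apply, Finsupp.smul_apply, smul_eq_mul, mul_left_comm _ r,
          ← Finset.mul_sum, hx]
      | hb g' =>
        simp only [hF, map_smul, Basis.repr_self, Finsupp.smul_apply, smul_eq_mul, ← mul_assoc,
          ← mul_pow, ← Finset.sum_mul]
        by_cases hg : π g = π g'
        · by_cases hne : g = g'
          · subst hne
            simp
          · rw [geom g g' hg hne, zero_mul, Finsupp.single_eq_of_ne hne, mul_zero]
        · rw [Finsupp.single_eq_of_ne hg, Finsupp.single_eq_of_ne (fun e => hg (by rw [e])),
            mul_zero, mul_zero]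
    refine (injective_iff_map_eq_zero F).2 fun x hx => ?_
    refine (basis _).repr.map_eq_zero_iff.1 (Finsupp.ext fun g => ?_)
    have := key g x
    rw [hx] at this
    simpa [hp] using this.symm
  have hsurj : Function.Surjective F := by
    have hroot := IsPrimitiveRoot.coe_units_iff.2 h.primitive
    have single : ∀ q (i : Fin p), Pi.single i (basis a q) ∈ F.toLinearMap.range := by
      intro q i
      obtain ⟨g, rfl⟩ := h.surjective q
      -- Averaging over the coset of g against χ^(-i) isolates the i-th factor, by orthogonality of
      -- the powers of χ on ⟨z⟩.
      refine ⟨∑ k : Fin p, ((p : ℂ)⁻¹ * ((χ (g * z ^ (k : ℕ)) : ℂ)⁻¹) ^ (i : ℕ)) •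
        basis _ (g * z ^ (k : ℕ)), ?_⟩
      have hπ : ∀ k : ℕ, π (g * z ^ k) = π g := fun k => by
        have := h.map_zpow_eq_one k
        rw [zpow_natCast] at this
        rw [map_mul, this, mul_one]
      funext j
      simp only [AlgHom.toLinearMap_apply, map_sum, map_smul, Finset.sum_apply, Pi.smul_apply, hF,
        hπ, smul_smul, ← Finset.sum_smul]
      by_cases hij : i = j
      · subst hij
        have : ∀ k : Fin p, (p : ℂ)⁻¹ * ((χ (g * z ^ (k : ℕ)) : ℂ)⁻¹) ^ (i : ℕ) *
            (χ (g * z ^ (k : ℕ)) : ℂ) ^ (i : ℕ) = (p : ℂ)⁻¹ := fun k => by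
          rw [mul_assoc, ← mul_pow, inv_mul_cancel₀ (Units.ne_zero _), one_pow, mul_one]
        simp only [this, Finset.sum_const, Finset.card_univ, Fintype.card_fin, nsmul_eq_mul,
          mul_inv_cancel₀ hp0, one_smul, Pi.single_eq_same]
      · rw [Pi.single_eq_of_ne' hij]
        let r : ℂ := ((χ z : ℂ)⁻¹) ^ (i : ℕ) * (χ z : ℂ) ^ (j : ℕ)
        have hr : r ≠ 1 := fun hr => by
          simp only [r] at hr
          rw [inv_pow, inv_mul_eq_one₀ (pow_ne_zero _ (Units.ne_zero _))] at hr
          exact hij (Fin.ext (hroot.pow_inj i.2 j.2 hr))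
        have hrp : r ^ p = 1 := by
          rw [mul_pow, ← pow_mul, ← pow_mul, mul_comm _ p, mul_comm _ p, pow_mul, pow_mul, inv_pow,
            hroot.pow_eq_one, inv_one, one_pow, one_pow, one_mul]
        have : ∀ k : Fin p, (p : ℂ)⁻¹ * ((χ (g * z ^ (k : ℕ)) : ℂ)⁻¹) ^ (i : ℕ) *
            (χ (g * z ^ (k : ℕ)) : ℂ) ^ (j : ℕ) =
            (p : ℂ)⁻¹ * ((χ g : ℂ)⁻¹) ^ (i : ℕ) * (χ g : ℂ) ^ (j : ℕ) * r ^ (k : ℕ) := fun k => by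
          simp only [r, map_mul, map_pow, Units.val_mul, Units.val_pow_eq_pow_val, mul_inv]
          ring
        simp only [this]
        rw [← Finset.mul_sum, sum_fin_pow_eq_zero hr hrp, mul_zero, zero_smul]
    have : F.toLinearMap.range = ⊤ := by
      rw [eq_top_iff]
      intro y _
      rw [← Finset.univ_sum_single y]
      refine Submodule.sum_mem _ fun i _ => ?_
      generalize y i = t
      induction t using induction_basis with
      | h0 => simp
      | hadd x y hx hy => rw [Pi.single_add]; exact Submodule.add_mem _ hx hy
      | hsmul r x hx => rw [Pi.single_smul]; exact Submodule.smul_mem _ r hx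
      | hb q => exact single q i
    exact LinearMap.range_eq_top.1 this
  exact ⟨AlgEquiv.ofBijective F ⟨hinj, hsurj⟩⟩

end SplitByCharacter

/-- Two groups that are extensions of the same group by cyclic kernels of order `p`, with characters
faithful on the kernels and with kernels that stay central in every extension by `ℂˣ`, are twist
isomorphic. -/
theorem twistIsomorphic_of_splitByCharacter {G H Q : Type} [Group G] [Group H] [Group Q] {p : ℕ}
    (hp : p ≠ 0) {π : G →* Q} {z : G} {χ : G →* ℂˣ} (h : SplitByCharacter p π z χ)
    {π' : H →* Q} {z' : H} {χ' : H →* ℂˣ} (h' : SplitByCharacter p π' z' χ')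
    (hs : ∀ c : TwoCocycle G ℂ, ∃ x : CocycleExtension c, x.base = z ∧ ∀ y, Commute x y)
    (hs' : ∀ c : TwoCocycle H ℂ, ∃ x : CocycleExtension c, x.base = z' ∧ ∀ y, Commute x y) :
    TwistIsomorphic ℂ G H := by
  have surj : ∀ c : TwoCocycle G ℂ, ∃ a : TwoCocycle Q ℂ, (TwoCocycle.comap π a).cls = c.cls :=
    fun c => (hs c).elim fun x hx => h.exists_comap_cls_eq hp c x hx.1 hx.2
  have surj' : ∀ c : TwoCocycle H ℂ, ∃ a : TwoCocycle Q ℂ, (TwoCocycle.comap π' a).cls = c.cls :=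
    fun c => (hs' c).elim fun x hx => h'.exists_comap_cls_eq hp c x hx.1 hx.2
  have hsurj : Function.Surjective (TwoCocycle.comapCls ℂ π) := fun y => by
    obtain ⟨c, rfl⟩ := TwoCocycle.cls_surjective y
    exact surj c
  have hsurj' : Function.Surjective (TwoCocycle.comapCls ℂ π') := fun y => by
    obtain ⟨c, rfl⟩ := TwoCocycle.cls_surjective y
    exact surj' c
  have hker : (TwoCocycle.comapCls ℂ π).ker = (TwoCocycle.comapCls ℂ π').ker :=
    (h.comapCls_ker hp).trans (h'.comapCls_ker hp).symm
  let e := QuotientAddGroup.quotientKerEquivOfSurjective _ hsurj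
  let e' := QuotientAddGroup.quotientKerEquivOfSurjective _ hsurj'
  -- Both cohomology groups are quotients of Z²(Q, ℂˣ) by the same subgroup; ψ passes through this
  -- common quotient.
  refine ⟨e.symm.trans ((QuotientAddGroup.quotientAddEquivOfEq hker).trans e'), fun c d hcd => ?_⟩
  obtain ⟨a, ha⟩ := surj c
  have hc : e (QuotientAddGroup.mk a) = c.cls := ha
  rw [← hc, AddEquiv.trans_apply, AddEquiv.symm_apply_apply] at hcd
  have hd : (TwoCocycle.comap π' a).cls = d.cls := hcd
  obtain ⟨e₁⟩ := nonempty_algEquiv_of_cls_eq ha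
  obtain ⟨e₂⟩ := h.nonempty_algEquiv_pi hp a
  obtain ⟨e₃⟩ := h'.nonempty_algEquiv_pi hp a
  obtain ⟨e₄⟩ := nonempty_algEquiv_of_cls_eq hd
  exact ⟨e₁.symm.trans (e₂.trans (e₃.symm.trans e₄))⟩

end

/-! ### The presented groups, their generators and homomorphisms -/

noncomputable section

open Phi2Gen

/-- The function on generators sending `α`, `α₁`, `α₂` to `x`, `y`, `w`. -/
def phi2Fun {Γ : Type} (x y w : Γ) : Phi2Gen → Γ
  | .a => x
  | .a₁ => y
  | .a₂ => w

theorem phi2Rels_lift_eq_one {Γ : Type} [Group Γ] {p m : ℕ} {x y w : Γ}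
    (hw : y * x = w * (x * y)) (hxw : Commute x w) (hyw : Commute y w)
    (hx : x ^ m = 1) (hy : y ^ p = 1) (hwp : w ^ p = 1) :
    ∀ r ∈ phi2Rels p m, FreeGroup.lift (phi2Fun x y w) r = 1 := by
  have h1 : y * x * y⁻¹ * x⁻¹ * w⁻¹ = 1 := by
    rw [hw]
    group
  intro r hr
  simp only [phi2Rels, Set.mem_insert_iff, Set.mem_singleton_iff] at hr
  rcases hr with rfl | rfl | rfl | rfl | rfl | rfl
  · simpa [commutatorElement_def, phi2Fun] using h1
  · simpa [phi2Fun] using commutatorElement_eq_one_iff_commute.2 hxw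
  · simpa [phi2Fun] using commutatorElement_eq_one_iff_commute.2 hyw
  · simpa [phi2Fun] using hx
  · simpa [phi2Fun] using hy
  · simpa [phi2Fun] using hwp

/-- The generators of the presented group. -/
abbrev phi2Of (p m : ℕ) (i : Phi2Gen) : PresentedGroup (phi2Rels p m) := PresentedGroup.of i

section Relations

variable (p m : ℕ)

open FreeGroup commutatorElement in
theorem phi2Of_comm : phi2Of p m a₁ * phi2Of p m a =
    phi2Of p m a₂ * (phi2Of p m a * phi2Of p m a₁) := by
  have : PresentedGroup.mk (phi2Rels p m) (⁅of a₁, of a⁆ * (of a₂)⁻¹) = 1 :=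
    PresentedGroup.one_of_mem (by simp [phi2Rels])
  rw [_root_.map_mul, _root_.map_inv, mul_inv_eq_one, map_commutatorElement, commutatorElement_def,
    mul_inv_eq_iff_eq_mul, mul_inv_eq_iff_eq_mul, mul_assoc] at this
  exact this

open FreeGroup commutatorElement in
theorem phi2Of_commute_a : Commute (phi2Of p m a) (phi2Of p m a₂) := by
  have : PresentedGroup.mk (phi2Rels p m) ⁅of a, of a₂⁆ = 1 :=
    PresentedGroup.one_of_mem (by simp [phi2Rels])
  rwa [map_commutatorElement, commutatorElement_eq_one_iff_commute] at this

open FreeGroup commutatorElement in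
theorem phi2Of_commute_a₁ : Commute (phi2Of p m a₁) (phi2Of p m a₂) := by
  have : PresentedGroup.mk (phi2Rels p m) ⁅of a₁, of a₂⁆ = 1 :=
    PresentedGroup.one_of_mem (by simp [phi2Rels])
  rwa [map_commutatorElement, commutatorElement_eq_one_iff_commute] at this

open FreeGroup in
theorem phi2Of_a_pow : phi2Of p m a ^ m = 1 := by
  have : PresentedGroup.mk (phi2Rels p m) (of a ^ m) = 1 :=
    PresentedGroup.one_of_mem (by simp [phi2Rels])
  rwa [map_pow] at this

open FreeGroup in
theorem phi2Of_a₁_pow : phi2Of p m a₁ ^ p = 1 := by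
  have : PresentedGroup.mk (phi2Rels p m) (of a₁ ^ p) = 1 :=
    PresentedGroup.one_of_mem (by simp [phi2Rels])
  rwa [map_pow] at this

open FreeGroup in
theorem phi2Of_a₂_pow : phi2Of p m a₂ ^ p = 1 := by
  have : PresentedGroup.mk (phi2Rels p m) (of a₂ ^ p) = 1 :=
    PresentedGroup.one_of_mem (by simp [phi2Rels])
  rwa [map_pow] at this

end Relations

/-- The homomorphism sending `α`, `α₁`, `α₂` to given elements satisfying the relations. -/
def phi2Lift {Γ : Type} [Group Γ] {p m : ℕ} {x y w : Γ}
    (hw : y * x = w * (x * y)) (hxw : Commute x w) (hyw : Commute y w)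
    (hx : x ^ m = 1) (hy : y ^ p = 1) (hwp : w ^ p = 1) : PresentedGroup (phi2Rels p m) →* Γ :=
  PresentedGroup.toGroup (phi2Rels_lift_eq_one hw hxw hyw hx hy hwp)

section Lift

variable {Γ : Type} [Group Γ] {p m : ℕ} {x y w : Γ}
  (hw : y * x = w * (x * y)) (hxw : Commute x w) (hyw : Commute y w)
  (hx : x ^ m = 1) (hy : y ^ p = 1) (hwp : w ^ p = 1)

theorem phi2Lift_a : phi2Lift hw hxw hyw hx hy hwp (phi2Of p m a) = x :=
  PresentedGroup.toGroup.of _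

theorem phi2Lift_a₁ : phi2Lift hw hxw hyw hx hy hwp (phi2Of p m a₁) = y :=
  PresentedGroup.toGroup.of _

theorem phi2Lift_a₂ : phi2Lift hw hxw hyw hx hy hwp (phi2Of p m a₂) = w :=
  PresentedGroup.toGroup.of _

end Lift

theorem phi2_closure (p m : ℕ) :
    Subgroup.closure {phi2Of p m a, phi2Of p m a₁, phi2Of p m a₂} = ⊤ := by
  rw [eq_top_iff, ← PresentedGroup.closure_range_of]
  refine Subgroup.closure_mono ?_
  rintro _ ⟨i, rfl⟩
  cases i <;> simp [phi2Of]

theorem closure_prod_cyclic {G : Type} [Group G] {S : Set G} (hS : Subgroup.closure S = ⊤) (n : ℕ) :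
    Subgroup.closure (insert ((1, Multiplicative.ofAdd 1) : G × Multiplicative (ZMod n))
      ((fun s => (s, 1)) '' S)) = ⊤ := by
  set K := Subgroup.closure (insert ((1, Multiplicative.ofAdd 1) : G × Multiplicative (ZMod n))
      ((fun s => (s, 1)) '' S)) with hK
  rw [eq_top_iff]
  rintro ⟨g, t⟩ -
  have h1 : ((g, 1) : G × Multiplicative (ZMod n)) ∈ K := by
    have : Subgroup.closure S ≤ K.comap (MonoidHom.inl G (Multiplicative (ZMod n))) := by
      rw [Subgroup.closure_le]
      exact fun s hs => Subgroup.subset_closure (Set.mem_insert_of_mem _ ⟨s, hs, rfl⟩)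
    exact this (hS ▸ Subgroup.mem_top g)
  have h2 : ((1, t) : G × Multiplicative (ZMod n)) ∈ K := by
    obtain ⟨k, hk⟩ := ZMod.intCast_surjective (Multiplicative.toAdd t)
    have : ((1, Multiplicative.ofAdd 1) : G × Multiplicative (ZMod n)) ^ k ∈ K :=
      Subgroup.zpow_mem _ (Subgroup.subset_closure (Set.mem_insert _ _)) k
    rw [Prod.pow_mk, one_zpow, ← ofAdd_zsmul, zsmul_one, hk, ofAdd_toAdd] at this
    exact this
  simpa using Subgroup.mul_mem _ h1 h2

/-! ### Powers of lifts that commute in the extension -/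

namespace CocycleExtension

variable {G R : Type} [Group G] [CommRing R] (c : TwoCocycle G R)

/-- If `x` and `y` have commuting images and the `n`-th power of the image of `y` is trivial, then
the `n`-th power of `x` commutes with `y`. -/
theorem commute_pow {x y : CocycleExtension c} (h : Commute x.base y.base) {n : ℕ}
    (hy : y.base ^ n = 1) : Commute (x ^ n) y := by
  have hm : (x * y * (y * x)⁻¹).base = 1 := by
    rw [mul_base, inv_base, mul_base, mul_base, h.eq, mul_inv_cancel]
  refine (commute_pow_left_of_commute_pow_right (m := x * y * (y * x)⁻¹)
    (inv_mul_cancel_right _ _).symm (commute_of_base_eq_one c hm _)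
    (commute_of_base_eq_one c hm _) ?_).2
  -- The power y ^ n lies over 1, hence is a central scalar.
  exact (commute_of_base_eq_one c (by rw [pow_base, hy]) x).symm

/-- If the images of `a`, `b` have a central commutator `w`, with `b ^ n = w ^ n = 1` in the base
and `n` odd, then `a ^ n` commutes with `b`. -/
theorem commute_pow_of_odd {a b : CocycleExtension c} {w : G}
    (hw : b.base * a.base = w * (a.base * b.base)) (ha : Commute a.base w) (hb : Commute b.base w)
    {n : ℕ} (hn : Odd n) (hbn : b.base ^ n = 1) (hwn : w ^ n = 1) : Commute (a ^ n) b := by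
  let v : CocycleExtension c := b * a * (a * b)⁻¹
  have hv : v.base = w := by
    change b.base * a.base * (a.base * b.base)⁻¹ = w
    rw [hw, mul_inv_cancel_right]
  have hvab : v * (a * b) = b * a := inv_mul_cancel_right _ _
  clear_value v
  -- The commutator v lies over w, so its commutator with any lift of an element commuting with w is
  -- a scalar.
  have cen : ∀ x : CocycleExtension c, Commute x.base w → ∀ y,
      Commute (v * x * (x * v)⁻¹) y := fun x hx y => by
    refine commute_of_base_eq_one c ?_ y
    rw [mul_base, inv_base, mul_base, mul_base, hv, hx.eq, mul_inv_cancel]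
  have hvn : ∀ y, Commute y (v ^ n) := fun y =>
    (commute_of_base_eq_one c (by rw [pow_base, hv, hwn]) y).symm
  exact commute_pow_of_class_three (w := v) (m := v * a * (a * v)⁻¹) (k := v * b * (b * v)⁻¹)
    hvab.symm (inv_mul_cancel_right _ _).symm
    (inv_mul_cancel_right _ _).symm (cen a ha _) (cen a ha _) (cen b hb _) (cen b hb _) hn
    (commute_of_base_eq_one c (by rw [pow_base, hbn]) a).symm (hvn a) (hvn b)

end CocycleExtension

/-- A complex character of `ZMod n` with a prescribed `n`-th root of unity as value at `1`. -/
def zmodChar (n : ℕ) (ω : ℂˣ) (hω : ω ^ n = 1) : Multiplicative (ZMod n) →* ℂˣ :=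
  AddMonoidHom.toMultiplicativeLeft
    (ZMod.lift n ⟨zmultiplesHom (Additive ℂˣ) (Additive.ofMul ω), by
      simpa [← ofMul_pow] using congrArg Additive.ofMul hω⟩)

theorem zmodChar_one (n : ℕ) (ω : ℂˣ) (hω : ω ^ n = 1) :
    zmodChar n ω hω (Multiplicative.ofAdd 1) = ω := by
  have := ZMod.lift_coe n ⟨zmultiplesHom (Additive ℂˣ) (Additive.ofMul ω), by
      simpa [← ofMul_pow] using congrArg Additive.ofMul hω⟩ 1
  rw [Int.cast_one] at this
  simpa [zmodChar] using congrArg Additive.toMul this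

theorem exists_primitiveRoot_units (n : ℕ) (hn : n ≠ 0) : ∃ ω : ℂˣ, IsPrimitiveRoot ω n :=
  ⟨_, (Complex.isPrimitiveRoot_exp n hn).isUnit_unit hn⟩

/-! ### The group ES_p × C_{p²} -/

section FirstGroup

variable (p : ℕ)

/-- Reduction `ES p × C_{p²} → ES p × C_p`. -/
def phi2_2111d_proj : Phi2_2111d p →* ES p × Multiplicative (ZMod p) :=
  (MonoidHom.id _).prodMap
    (AddMonoidHom.toMultiplicative (ZMod.castHom (dvd_pow_self p two_ne_zero) (ZMod p)).toAddMonoidHom)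

/-- The character sends the generator of C_{p²} to a primitive p²-th root of unity ω, so its value
at z is ω ^ p, of order p. -/
theorem splitByCharacter_phi2_2111d [Fact p.Prime] : ∃ χ : Phi2_2111d p →* ℂˣ, SplitByCharacter p
    (phi2_2111d_proj p) ((1, Multiplicative.ofAdd 1) ^ p) χ := by
  have hp0 : p ≠ 0 := (Fact.out : p.Prime).ne_zero
  obtain ⟨ω, hω⟩ := exists_primitiveRoot_units (p ^ 2) (pow_ne_zero 2 hp0)
  refine ⟨(zmodChar (p ^ 2) ω hω.pow_eq_one).comp (MonoidHom.snd _ _), ?_, ?_, ?_, ?_⟩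
  · refine Function.Surjective.prodMap Function.surjective_id ?_
    exact ZMod.castHom_surjective (dvd_pow_self p two_ne_zero)
  · ext ⟨g, t⟩
    rw [MonoidHom.mem_ker, Subgroup.mem_zpowers_iff]
    obtain ⟨k, hk⟩ := ZMod.intCast_surjective (Multiplicative.toAdd t)
    obtain rfl : t = Multiplicative.ofAdd (k : ZMod (p ^ 2)) := by rw [hk, ofAdd_toAdd]
    have : phi2_2111d_proj p (g, Multiplicative.ofAdd (k : ZMod (p ^ 2))) =
      (g, Multiplicative.ofAdd (k : ZMod p)) := by
      refine Prod.ext rfl ?_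
      exact congrArg Multiplicative.ofAdd (map_intCast (ZMod.castHom (dvd_pow_self p two_ne_zero) (ZMod p)) k)
    rw [this, Prod.mk_eq_one, ofAdd_eq_one, ZMod.intCast_zmod_eq_zero_iff_dvd]
    constructor
    · rintro ⟨rfl, j, rfl⟩
      refine ⟨j, ?_⟩
      rw [← zpow_natCast, ← zpow_mul, Prod.pow_mk, one_zpow, ← ofAdd_zsmul, zsmul_one]
    · rintro ⟨j, hj⟩
      rw [← zpow_natCast, ← zpow_mul, Prod.pow_mk, one_zpow, ← ofAdd_zsmul, zsmul_one,
        Prod.mk_inj] at hj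
      refine ⟨hj.1.symm, ?_⟩
      have h2 := Multiplicative.ofAdd.injective hj.2
      rw [ZMod.intCast_eq_intCast_iff_dvd_sub] at h2
      have h3 : (p : ℤ) ∣ k - p * j := (dvd_pow_self (p : ℤ) two_ne_zero).trans (by exact_mod_cast h2)
      simpa using dvd_add h3 (dvd_mul_right (p : ℤ) j)
  · rw [← pow_mul, ← sq, Prod.pow_mk, one_pow, ← ofAdd_nsmul]
    simp
  · have : ((zmodChar (p ^ 2) ω hω.pow_eq_one).comp (MonoidHom.snd (ES p) _))
        ((1, Multiplicative.ofAdd 1) ^ p) = ω ^ p := by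
      rw [map_pow, MonoidHom.comp_apply, MonoidHom.coe_snd, zmodChar_one]
    rw [this]
    exact hω.pow (pow_pos (Nat.pos_of_ne_zero hp0) 2) (sq p)

/-- All generators of ES_p have p-th power 1 and commute with the cyclic factor, so the p-th power
of any lift of its generator commutes with their lifts. -/
theorem exists_central_lift_phi2_2111d (c : TwoCocycle (Phi2_2111d p) ℂ) :
    ∃ x : CocycleExtension c, x.base = (1, Multiplicative.ofAdd 1) ^ p ∧ ∀ y, Commute x y := by
  let t : CocycleExtension c := ⟨1, (1, Multiplicative.ofAdd 1)⟩
  refine ⟨t ^ p, CocycleExtension.pow_base c t p, CocycleExtension.commute_of_closure_eq_top c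
    (closure_prod_cyclic (phi2_closure p p) (p ^ 2)) ?_⟩
  have key : ∀ s : ES p, s ^ p = 1 →
      ∃ y : CocycleExtension c, y.base = (s, 1) ∧ Commute (t ^ p) y := fun s hs =>
    ⟨⟨1, (s, 1)⟩, rfl, CocycleExtension.commute_pow c
      (Prod.ext ((Commute.one_left s).eq) ((Commute.one_right _).eq))
      (by rw [Prod.pow_mk, hs, one_pow, Prod.mk_one_one])⟩
  rintro _ (rfl | ⟨s, rfl | rfl | rfl, rfl⟩)
  · exact ⟨t, rfl, (Commute.refl t).pow_left p⟩
  · exact key _ (phi2Of_a_pow p p)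
  · exact key _ (phi2Of_a₁_pow p p)
  · exact key _ (phi2Of_a₂_pow p p)

end FirstGroup

/-! ### The group φ₂(211)c × C_p -/

section SecondGroup

variable (p : ℕ)

/-- The quotient map `φ₂(211)c → ES p`. -/
def phi2_211c_proj : Phi2_211c p →* ES p :=
  phi2Lift (phi2Of_comm p p) (phi2Of_commute_a p p) (phi2Of_commute_a₁ p p)
    (by rw [sq, pow_mul, phi2Of_a_pow, one_pow]) (phi2Of_a₁_pow p p) (phi2Of_a₂_pow p p)

/-- Moving α^p past α₁ produces α₂^p = 1. -/
theorem phi2_a_pow_central (m : ℕ) (g : PresentedGroup (phi2Rels p m)) :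
    Commute (phi2Of p m a ^ p) g := by
  have h : Subgroup.closure {phi2Of p m a, phi2Of p m a₁, phi2Of p m a₂} ≤
      Subgroup.centralizer {phi2Of p m a ^ p} := by
    rw [Subgroup.closure_le]
    rintro _ (rfl | rfl | rfl) <;> refine Subgroup.mem_centralizer_singleton_iff.2 ?_
    · exact (Commute.refl _).pow_right p
    · have := mul_pow_mul_eq_pow_mul (phi2Of_comm p m) (phi2Of_commute_a p m).symm p
      rwa [phi2Of_a₂_pow, one_mul] at this
    · exact (phi2Of_commute_a p m).symm.pow_right p
  rw [phi2_closure] at h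
  exact (Subgroup.mem_centralizer_singleton_iff.1 (h (Subgroup.mem_top g))).symm

/-- Modulo α^p the relations of ES_p hold, so the quotient map factors through ES_p and the kernel
cannot be larger. No normal form or group order is needed. -/
theorem phi2_211c_proj_ker : (phi2_211c_proj p).ker = Subgroup.zpowers (phi2Of p (p ^ 2) a ^ p) := by
  set N := Subgroup.zpowers (phi2Of p (p ^ 2) a ^ p) with hN
  have : N.Normal := ⟨by
    rintro _ ⟨k, rfl⟩ g
    refine ⟨k, ?_⟩
    have := ((phi2_a_pow_central p (p ^ 2) g).zpow_left k).eq
    exact (mul_inv_eq_iff_eq_mul.2 this.symm).symm⟩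
  let q := QuotientGroup.mk' N
  let ρ : ES p →* Phi2_211c p ⧸ N := phi2Lift (x := q (phi2Of p _ a)) (y := q (phi2Of p _ a₁))
    (w := q (phi2Of p _ a₂))
    (by rw [← map_mul, phi2Of_comm, map_mul, map_mul])
    ((phi2Of_commute_a p _).map q) ((phi2Of_commute_a₁ p _).map q)
    (by
      rw [← map_pow, QuotientGroup.mk'_apply, QuotientGroup.eq_one_iff]
      exact Subgroup.mem_zpowers _)
    (by rw [← map_pow, phi2Of_a₁_pow, map_one]) (by rw [← map_pow, phi2Of_a₂_pow, map_one])
  have hρ : ρ.comp (phi2_211c_proj p) = q := by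
    refine PresentedGroup.ext fun i => ?_
    change ρ (phi2_211c_proj p (phi2Of p _ i)) = q (phi2Of p _ i)
    cases i
    · rw [phi2_211c_proj, phi2Lift_a, phi2Lift_a]
    · rw [phi2_211c_proj, phi2Lift_a₁, phi2Lift_a₁]
    · rw [phi2_211c_proj, phi2Lift_a₂, phi2Lift_a₂]
  refine le_antisymm (fun g hg => ?_) ?_
  · rw [← QuotientGroup.eq_one_iff]
    change q g = 1
    rw [← hρ, MonoidHom.comp_apply, MonoidHom.mem_ker.1 hg, map_one]
  · rw [hN, Subgroup.zpowers_le, MonoidHom.mem_ker, map_pow, phi2_211c_proj, phi2Lift_a,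
      phi2Of_a_pow]

theorem phi2_211c_proj_surjective : Function.Surjective (phi2_211c_proj p) := by
  rw [← MonoidHom.range_eq_top, eq_top_iff, ← phi2_closure, Subgroup.closure_le]
  rintro _ (rfl | rfl | rfl)
  · exact ⟨phi2Of p _ a, phi2Lift_a ..⟩
  · exact ⟨phi2Of p _ a₁, phi2Lift_a₁ ..⟩
  · exact ⟨phi2Of p _ a₂, phi2Lift_a₂ ..⟩

/-- Sending α to a primitive p²-th root of unity and α₁, α₂ to 1 respects the relations. This also
shows that α^p does not collapse in the presentation. -/
theorem splitByCharacter_phi2_2111c [Fact p.Prime] : ∃ χ : Phi2_2111c p →* ℂˣ, SplitByCharacter p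
    ((phi2_211c_proj p).prodMap (MonoidHom.id (Multiplicative (ZMod p))))
      ((phi2Of p (p ^ 2) a, 1) ^ p) χ := by
  have hp0 : p ≠ 0 := (Fact.out : p.Prime).ne_zero
  obtain ⟨ω, hω⟩ := exists_primitiveRoot_units (p ^ 2) (pow_ne_zero 2 hp0)
  let χ : Phi2_211c p →* ℂˣ := phi2Lift (x := ω) (y := 1) (w := 1) (by simp)
    (Commute.one_right _) (Commute.one_right _) hω.pow_eq_one (one_pow _) (one_pow _)
  refine ⟨χ.comp (MonoidHom.fst _ _), ?_, ?_, ?_, ?_⟩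
  · exact Function.Surjective.prodMap (phi2_211c_proj_surjective p) Function.surjective_id
  · ext ⟨g, t⟩
    rw [MonoidHom.mem_ker, MonoidHom.prodMap_def]
    change (phi2_211c_proj p g, t) = 1 ↔ _
    rw [Prod.mk_eq_one, ← MonoidHom.mem_ker, phi2_211c_proj_ker, Subgroup.mem_zpowers_iff,
      Subgroup.mem_zpowers_iff]
    simp only [Prod.pow_mk, one_pow, one_zpow, Prod.mk_inj, exists_and_right, eq_comm]
  · rw [← pow_mul, ← sq, Prod.pow_mk, one_pow, phi2Of_a_pow, Prod.mk_one_one]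
  · have : (χ.comp (MonoidHom.fst _ (Multiplicative (ZMod p)))) ((phi2Of p (p ^ 2) a, 1) ^ p) =
        ω ^ p := by
      rw [map_pow, MonoidHom.comp_apply, MonoidHom.coe_fst, phi2Lift_a]
    rw [this]
    exact hω.pow (pow_pos (Nat.pos_of_ne_zero hp0) 2) (sq p)

/-- Only α₁ fails to commute with α. Lifts of α, α₁ may have a commutator that is not central in the
extension, whence the class-three argument for odd p; the other generators need only the
scalar-commutator argument. -/
theorem exists_central_lift_phi2_2111c (hp : Odd p) (c : TwoCocycle (Phi2_2111c p) ℂ) :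
    ∃ x : CocycleExtension c, x.base = (phi2Of p (p ^ 2) a, 1) ^ p ∧ ∀ y, Commute x y := by
  let x : CocycleExtension c := ⟨1, (phi2Of p (p ^ 2) a, 1)⟩
  refine ⟨x ^ p, CocycleExtension.pow_base c x p, CocycleExtension.commute_of_closure_eq_top c
    (closure_prod_cyclic (phi2_closure p (p ^ 2)) p) ?_⟩
  rintro _ (rfl | ⟨s, rfl | rfl | rfl, rfl⟩)
  · refine ⟨⟨1, (1, Multiplicative.ofAdd 1)⟩, rfl, CocycleExtension.commute_pow c
      (Prod.ext ((Commute.one_right _).eq) ((Commute.one_left _).eq)) ?_⟩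
    rw [Prod.pow_mk, one_pow, ← ofAdd_nsmul]
    simp
  · exact ⟨x, rfl, (Commute.refl x).pow_left p⟩
  · refine ⟨⟨1, (phi2Of p (p ^ 2) a₁, 1)⟩, rfl, CocycleExtension.commute_pow_of_odd c
      (w := (phi2Of p (p ^ 2) a₂, 1)) (Prod.ext (phi2Of_comm p _) (by simp [x]))
      (Prod.ext (phi2Of_commute_a p _).eq rfl) (Prod.ext (phi2Of_commute_a₁ p _).eq rfl) hp ?_ ?_⟩
    · rw [Prod.pow_mk, phi2Of_a₁_pow, one_pow, Prod.mk_one_one]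
    · rw [Prod.pow_mk, phi2Of_a₂_pow, one_pow, Prod.mk_one_one]
  · refine ⟨⟨1, (phi2Of p (p ^ 2) a₂, 1)⟩, rfl, CocycleExtension.commute_pow c
      (Prod.ext (phi2Of_commute_a p _).eq (Commute.refl 1).eq) ?_⟩
    rw [Prod.pow_mk, phi2Of_a₂_pow, one_pow, Prod.mk_one_one]

end SecondGroup

end

theorem mainTheorem4 (p : ℕ) (hp : p.Prime) (hodd : p ≠ 2) :
    TwistIsomorphic ℂ (Phi2_2111d p) (Phi2_2111c p) := by
  have : Fact p.Prime := ⟨hp⟩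
  obtain ⟨χ, hχ⟩ := splitByCharacter_phi2_2111d p
  obtain ⟨χ', hχ'⟩ := splitByCharacter_phi2_2111c p
  exact twistIsomorphic_of_splitByCharacter hp.ne_zero hχ hχ' (exists_central_lift_phi2_2111d p)
    (exists_central_lift_phi2_2111c p (hp.odd_of_ne_two hodd))
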